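/- Let $d\in\mathbb N$. For an open set $\Omega\subset\mathbb R^d$ let $\mathcal G(\Omega)=\mathcal F(C^\infty(\Omega))/\mathcal N(C^\infty(\Omega))$ be the simplified Colombeau algebra: with $p_{K,l}(f)=\sup_{|\alpha|\le l,\,x\in K}|\partial^\alpha f(x)|$ for $K\subset\Omega$ compact and $l\in\mathbb N$, a net $(f_\varepsilon)_{\varepsilon\in(0,1]}$ of complex valued smooth functions on $\Omega$ lies in $\mathcal F(C^\infty(\Omega))$ if for all $K,l$ there is $q\in\mathbb N$ with $p_{K,l}(f_\varepsilon)=o(\varepsilon^{-q})$ as $\varepsilon\to0$, and in $\mathcal N(C^\infty(\Omega))$ if for all $K,l$ and all $p\in\mathbb N$ one has $p_{K,l}(f_\varepsilon)=o(\varepsilon^{p})$ as $\varepsilon\to 0$. Let $\rho\in\mathcal S(\mathbb R^d)$ be even with $\int\rho=1$ and $\int x^m\rho(x)\,dx=0$ for all $m\in\mathbb N^d\setminus\{0\}$, and put $\rho_\varepsilon(x)=\varepsilon^{-d}\rho(x/\varepsilon)$ for $\varepsilon\in(0,1]$. Let $\chi\in\mathcal D(\mathbb R^d)$ with $0\le\chi\le1$,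 $\chi=1$ on $\overline{B(0,1)}$ and $\chi=0$ outside $B(0,2)$, and put $\theta_\varepsilon(x)=\rho_\varepsilon(x)\,\chi(x|\ln\varepsilon|)$ for $\varepsilon\in(0,1)$. Let $(\Omega_\lambda)_{\lambda\in\Lambda}$ be a locally finite covering of $\mathbb R^d$ by relatively compact open sets, and let $\psi_\lambda\in\mathcal D(\mathbb R^d)$ with $0\le\psi_\lambda\le1$ and $\psi_\lambda=1$ on a neighbourhood of $\overline{\Omega_\lambda}$. Then $(S*\rho_\varepsilon)_\varepsilon\in\mathcal F(C^\infty(\mathbb R^d))$ for every $S\in\mathcal E'(\mathbb R^d)$ and $(T*\theta_\varepsilon)_\varepsilon\in\mathcal F(C^\infty(\mathbb R^d))$ for every $T\in\mathcal D'(\mathbb R^d)$ (the value of the latter net at $\varepsilon=1$ is irrelevant and is set to $0$), so that the maps $$\iota_0:\mathcal E'(\mathbb R^d)\to\mathcal G(\mathbb R^d),\quad S\mapsto (S*\rho_\varepsilon)_\varepsilon+\mathcal N(C^\infty(\mathbb R^d)),\qquad \iota_S:\mathcal D'(\mathbb R^d)\to\mathcal G(\mathbb R^d),\quad T\mapsto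 (T*\theta_\varepsilon)_\varepsilon+\mathcal N(C^\infty(\mathbb R^d))$$ are well defined; there is exactly one map $\iota_A:\mathcal D'(\mathbb R^d)\to\mathcal G(\mathbb R^d)$ such that $\iota_A(T)|_{\Omega_\lambda}=\iota_0(\psi_\lambda T)|_{\Omega_\lambda}$ for all $\lambda\in\Lambda$ and all $T\in\mathcal D'(\mathbb R^d)$; and $\iota_A=\iota_S$. -/

import Mathlib

open Filter Topology Set MeasureTheory TopologicalSpace Asymptotics
open scoped ContDiff Distributions SchwartzMap

namespace Colombeau

/-- The Euclidean space `ℝ^d`. -/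
abbrev Sp (d : ℕ) : Type := EuclideanSpace ℝ (Fin d)

/-- The index set `(0,1]` of the nets. -/
abbrev Idx : Type := Set.Ioc (0 : ℝ) 1

/-- The filter `ε → 0` on `(0,1]`. -/
def toZero : Filter Idx := Filter.comap (fun ε : Idx => (ε : ℝ)) (𝓝 0)

variable {d : ℕ}

/-! ### Smooth functions on an open set and their seminorms -/

/-- Extension by zero to `ℝ^d` of a function on an open set `Ω`; it only serves to speak of the
derivatives at points of `Ω`. -/
noncomputable def ext {Ω : Opens (Sp d)} (f : Ω → ℂ) : Sp d → ℂ :=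
  Function.extend Subtype.val f 0

theorem ext_apply {Ω : Opens (Sp d)} (f : Ω → ℂ) {x : Sp d} (hx : x ∈ Ω) :
    ext f x = f ⟨x, hx⟩ :=
  Subtype.val_injective.extend_apply f 0 ⟨x, hx⟩

theorem ext_add {Ω : Opens (Sp d)} (f g : Ω → ℂ) : ext (f + g) = ext f + ext g := by
  have := Function.extend_add (Subtype.val : Ω → Sp d) f g 0 0
  simpa [ext] using this

theorem ext_mul {Ω : Opens (Sp d)} (f g : Ω → ℂ) : ext (f * g) = ext f * ext g := by
  have := Function.extend_mul (Subtype.val : Ω → Sp d) f g 0 0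
  simpa [ext] using this

/-- The smooth functions on the open set `Ω`, as a subalgebra of the algebra of all complex valued
functions on `Ω`. -/
noncomputable def smoothSubalgebra (Ω : Opens (Sp d)) : Subalgebra ℂ (Ω → ℂ) where
  carrier := {f | ContDiffOn ℝ ∞ (ext f) Ω}
  mul_mem' := by
    intro f g hf hg
    change ContDiffOn ℝ ∞ (ext (f * g)) Ω
    rw [ext_mul]
    exact ContDiffOn.mul hf hg
  add_mem' := by
    intro f g hf hg
    change ContDiffOn ℝ ∞ (ext (f + g)) Ω
    rw [ext_add]
    exact ContDiffOn.add hf hg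
  algebraMap_mem' := by
    intro c
    refine (contDiffOn_const (c := c)).congr ?_
    intro x hx
    rw [ext_apply _ hx]
    rfl

/-- The algebra `C^∞(Ω)` of complex valued smooth functions on the open set `Ω`. -/
def Smooth (Ω : Opens (Sp d)) : Type := smoothSubalgebra Ω

noncomputable instance (Ω : Opens (Sp d)) : CommRing (Smooth Ω) :=
  inferInstanceAs (CommRing (smoothSubalgebra Ω))

noncomputable instance (Ω : Opens (Sp d)) : Algebra ℂ (Smooth Ω) :=
  inferInstanceAs (Algebra ℂ (smoothSubalgebra Ω))

theorem Smooth.contDiffOn {Ω : Opens (Sp d)} (f : Smooth Ω) : ContDiffOn ℝ ∞ (ext f.1) Ω := f.2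

/-- The restriction to `Ω` of a smooth function on `ℝ^d`. -/
noncomputable def Smooth.of (Ω : Opens (Sp d)) (f : Sp d → ℂ) (hf : ContDiff ℝ ∞ f) : Smooth Ω :=
  ⟨fun x => f x, hf.contDiffOn.congr fun _ hx => ext_apply _ hx⟩

/-- The seminorm `p_{K,l}(f) = sup_{k ≤ l, x ∈ K} |D^k f(x)|`, for a compact set `K ⊆ Ω`.
The norm of the `k`-th differential is equivalent to the maximum of the `|∂^α f(x)|`, `|α| = k`. -/
noncomputable def seminorm {Ω : Opens (Sp d)} (K : Set (Sp d)) (l : ℕ) (f : Smooth Ω) : ℝ :=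
  sSup {r : ℝ | ∃ k ≤ l, ∃ x ∈ K, r = ‖iteratedFDeriv ℝ k (ext f.1) x‖}

section SeminormFacts

variable {Ω : Opens (Sp d)} {K : Set (Sp d)} {l : ℕ}

theorem seminorm_nonneg (f : Smooth Ω) : 0 ≤ seminorm K l f := by
  refine Real.sSup_nonneg ?_
  rintro r ⟨k, _, x, _, rfl⟩
  exact norm_nonneg _

theorem seminorm_le {f : Smooth Ω} {C : ℝ} (hC : 0 ≤ C)
    (h : ∀ k ≤ l, ∀ x ∈ K, ‖iteratedFDeriv ℝ k (ext f.1) x‖ ≤ C) : seminorm K l f ≤ C := by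
  refine Real.sSup_le ?_ hC
  rintro r ⟨k, hk, x, hx, rfl⟩
  exact h k hk x hx

theorem le_seminorm (hK : IsCompact K) (hKΩ : K ⊆ Ω) (f : Smooth Ω) {k : ℕ} (hk : k ≤ l)
    {x : Sp d} (hx : x ∈ K) : ‖iteratedFDeriv ℝ k (ext f.1) x‖ ≤ seminorm K l f := by
  refine le_csSup ?_ ⟨k, hk, x, hx, rfl⟩
  have hb : ∀ j : ℕ, ∃ C, ∀ x ∈ K, ‖iteratedFDeriv ℝ j (ext f.1) x‖ ≤ C := by
    intro j
    have hc : ContinuousOn (iteratedFDeriv ℝ j (ext f.1)) Ω := by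
      refine (f.contDiffOn.continuousOn_iteratedFDerivWithin (m := j) (mod_cast le_top)
        Ω.isOpen.uniqueDiffOn).congr ?_
      intro x hx
      exact (iteratedFDerivWithin_of_isOpen j Ω.isOpen hx).symm
    exact hK.exists_bound_of_continuousOn (hc.mono hKΩ)
  choose C hC using hb
  refine ⟨∑ j ∈ Finset.range (l + 1), |C j|, ?_⟩
  rintro r ⟨j, hj, y, hy, rfl⟩
  refine ((hC j y hy).trans (le_abs_self _)).trans ?_
  exact Finset.single_le_sum (f := fun j => |C j|) (fun _ _ => abs_nonneg _)
    (Finset.mem_range.2 (Nat.lt_succ_of_le hj))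

theorem seminorm_add_le (hK : IsCompact K) (hKΩ : K ⊆ Ω) (f g : Smooth Ω) :
    seminorm K l (f + g) ≤ seminorm K l f + seminorm K l g := by
  refine seminorm_le (add_nonneg (seminorm_nonneg f) (seminorm_nonneg g)) ?_
  intro k hk x hx
  have e : ext (f + g).1 = ext f.1 + ext g.1 := ext_add _ _
  have hf : ContDiffAt ℝ k (ext f.1) x :=
    ((f.contDiffOn.contDiffAt (Ω.isOpen.mem_nhds (hKΩ hx))).of_le (mod_cast le_top))
  have hg : ContDiffAt ℝ k (ext g.1) x :=
    ((g.contDiffOn.contDiffAt (Ω.isOpen.mem_nhds (hKΩ hx))).of_le (mod_cast le_top))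
  rw [e, iteratedFDeriv_add_apply hf hg]
  exact (norm_add_le _ _).trans
    (add_le_add (le_seminorm hK hKΩ f hk hx) (le_seminorm hK hKΩ g hk hx))

theorem norm_iteratedFDeriv_mul_le_of_mem (f g : Smooth Ω) {x : Sp d} (hx : x ∈ Ω) (k : ℕ) :
    ‖iteratedFDeriv ℝ k (ext (f * g).1) x‖ ≤ ∑ i ∈ Finset.range (k + 1), (k.choose i : ℝ) *
      ‖iteratedFDeriv ℝ i (ext f.1) x‖ * ‖iteratedFDeriv ℝ (k - i) (ext g.1) x‖ := by
  have e : ext (f * g).1 = fun y => ext f.1 y * ext g.1 y := ext_mul _ _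
  have := norm_iteratedFDerivWithin_mul_le f.contDiffOn g.contDiffOn Ω.isOpen.uniqueDiffOn hx
    (n := k) (mod_cast le_top)
  simpa only [e, iteratedFDerivWithin_of_isOpen _ Ω.isOpen hx] using this

theorem seminorm_mul_le (hK : IsCompact K) (hKΩ : K ⊆ Ω) (f g : Smooth Ω) :
    seminorm K l (f * g) ≤ 2 ^ l * (seminorm K l f * seminorm K l g) := by
  have hf := seminorm_nonneg (K := K) (l := l) f
  have hg := seminorm_nonneg (K := K) (l := l) g
  refine seminorm_le (by positivity) ?_
  intro k hk x hx
  refine (norm_iteratedFDeriv_mul_le_of_mem f g (hKΩ hx) k).trans ?_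
  calc _ ≤ ∑ i ∈ Finset.range (k + 1), (k.choose i : ℝ) * (seminorm K l f * seminorm K l g) := by
        refine Finset.sum_le_sum fun i hi => ?_
        have hi' : i ≤ k := Nat.lt_succ_iff.1 (Finset.mem_range.1 hi)
        rw [mul_assoc]
        have h1 := le_seminorm hK hKΩ f (hi'.trans hk) hx
        have h2 := le_seminorm hK hKΩ g ((Nat.sub_le k i).trans hk) hx
        gcongr
    _ = 2 ^ k * (seminorm K l f * seminorm K l g) := by
        rw [← Finset.sum_mul]
        congr 1
        exact_mod_cast Nat.sum_range_choose k
    _ ≤ _ := by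
        gcongr
        norm_num

end SeminormFacts

/-! ### The Colombeau algebra `𝒢(Ω)` and its restriction maps -/

/-- The moderate nets, as a subalgebra of the algebra `C^∞(Ω)^{(0,1]}` of all nets. -/
noncomputable def moderateSubalgebra (Ω : Opens (Sp d)) : Subalgebra ℂ (Idx → Smooth Ω) where
  carrier := {f | ∀ (l : ℕ) (K : Set (Sp d)), IsCompact K → K ⊆ Ω → ∃ q : ℕ,
    (fun ε : Idx => seminorm K l (f ε)) =o[toZero] fun ε : Idx => (ε : ℝ) ^ (-(q : ℤ))}
  mul_mem' := by
    intro f g hf hg l K hK hKΩ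
    obtain ⟨q, hq⟩ := hf l K hK hKΩ
    obtain ⟨r, hr⟩ := hg l K hK hKΩ
    refine ⟨q + r, ?_⟩
    have h := ((hq.mul hr).const_mul_left (2 ^ l))
    refine IsBigO.trans_isLittleO (IsBigO.of_bound 1 (Eventually.of_forall fun ε => ?_))
      (h.congr_right fun ε => ?_)
    · have h1 := seminorm_mul_le (l := l) hK hKΩ (f ε) (g ε)
      rw [one_mul, Real.norm_of_nonneg (seminorm_nonneg _)]
      exact h1.trans (le_abs_self _)
    · have : (ε : ℝ) ≠ 0 := ε.2.1.ne'
      rw [← zpow_add₀ this]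
      push_cast
      ring_nf
  add_mem' := by
    intro f g hf hg l K hK hKΩ
    obtain ⟨q, hq⟩ := hf l K hK hKΩ
    obtain ⟨r, hr⟩ := hg l K hK hKΩ
    have key : ∀ a b : ℕ, a ≤ b → (fun ε : Idx => (ε : ℝ) ^ (-(a : ℤ))) =O[toZero]
        fun ε : Idx => (ε : ℝ) ^ (-(b : ℤ)) := by
      intro a b hab
      refine IsBigO.of_bound 1 (Eventually.of_forall fun ε => ?_)
      have h0 : (0 : ℝ) < ε := ε.2.1
      rw [one_mul, Real.norm_of_nonneg (by positivity), Real.norm_of_nonneg (by positivity)]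
      exact zpow_le_zpow_right_of_le_one₀ h0 ε.2.2 (by omega)
    refine ⟨q + r, ?_⟩
    have h := (hq.trans_isBigO (key q (q + r) (by omega))).add
      (hr.trans_isBigO (key r (q + r) (by omega)))
    refine IsBigO.trans_isLittleO (IsBigO.of_bound 1 (Eventually.of_forall fun ε => ?_)) h
    have h1 := seminorm_add_le (l := l) hK hKΩ (f ε) (g ε)
    rw [one_mul, Real.norm_of_nonneg (seminorm_nonneg _)]
    exact h1.trans (le_abs_self _)
  algebraMap_mem' := by
    intro c l K hK hKΩ
    refine ⟨1, ?_⟩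
    have h2 : Tendsto (fun ε : Idx => (ε : ℝ)) toZero (𝓝 0) := tendsto_comap
    have h3 : (fun _ : Idx => (1 : ℝ)) =o[toZero] fun ε : Idx => (ε : ℝ) ^ (-((1 : ℕ) : ℤ)) := by
      refine isLittleO_of_tendsto' (Eventually.of_forall fun ε h => ?_) (h2.congr fun ε => ?_)
      · exact absurd h (zpow_ne_zero _ ε.2.1.ne')
      · simp
    have h4 : (fun _ : Idx => seminorm K l (algebraMap ℂ (Smooth Ω) c)) =O[toZero]
        fun _ : Idx => (1 : ℝ) := isBigO_const_const _ one_ne_zero _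
    exact h4.trans_isLittleO h3

/-- The algebra `ℱ(C^∞(Ω))` of moderate nets. -/
def Moderate (Ω : Opens (Sp d)) : Type := moderateSubalgebra Ω

noncomputable instance (Ω : Opens (Sp d)) : CommRing (Moderate Ω) :=
  inferInstanceAs (CommRing (moderateSubalgebra Ω))

noncomputable instance (Ω : Opens (Sp d)) : Algebra ℂ (Moderate Ω) :=
  inferInstanceAs (Algebra ℂ (moderateSubalgebra Ω))

/-- The ideal `𝒩(C^∞(Ω))` of negligible nets. -/
noncomputable def Negligible (Ω : Opens (Sp d)) : Ideal (Moderate Ω) where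
  carrier := {f | ∀ (l : ℕ) (K : Set (Sp d)), IsCompact K → K ⊆ Ω → ∀ p : ℕ,
    (fun ε : Idx => seminorm K l (f.1 ε)) =o[toZero] fun ε : Idx => (ε : ℝ) ^ p}
  add_mem' := by
    intro f g hf hg l K hK hKΩ p
    refine IsBigO.trans_isLittleO (IsBigO.of_bound 1 (Eventually.of_forall fun ε => ?_))
      ((hf l K hK hKΩ p).add (hg l K hK hKΩ p))
    have h1 := seminorm_add_le (l := l) hK hKΩ (f.1 ε) (g.1 ε)
    rw [one_mul, Real.norm_of_nonneg (seminorm_nonneg _)]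
    exact h1.trans (le_abs_self _)
  zero_mem' := by
    intro l K hK hKΩ p
    have : ∀ ε : Idx, seminorm K l ((0 : Moderate Ω).1 ε) = 0 := by
      intro ε
      refine le_antisymm (seminorm_le le_rfl ?_) (seminorm_nonneg _)
      intro k _ x _
      have e : ext ((0 : Moderate Ω).1 ε).1 = 0 := by
        funext y
        by_cases hy : y ∈ Ω
        · rw [ext_apply _ hy]
          rfl
        · exact Function.extend_apply' _ _ _ (fun ⟨a, ha⟩ => hy (ha ▸ a.2))
      rw [e]
      simp
    simp only [this]
    exact isLittleO_zero _ _
  smul_mem' := by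
    intro c f hf l K hK hKΩ p
    obtain ⟨q, hq⟩ := c.2 l K hK hKΩ
    have h := ((hq.mul (hf l K hK hKΩ (p + q))).const_mul_left (2 ^ l))
    refine IsBigO.trans_isLittleO (IsBigO.of_bound 1 (Eventually.of_forall fun ε => ?_))
      (h.congr_right fun ε => ?_)
    · have h1 := seminorm_mul_le (l := l) hK hKΩ (c.1 ε) (f.1 ε)
      rw [one_mul, Real.norm_of_nonneg (seminorm_nonneg _)]
      exact h1.trans (le_abs_self _)
    · have : (ε : ℝ) ≠ 0 := ε.2.1.ne'
      rw [zpow_neg, zpow_natCast, pow_add]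
      field_simp

/-- The simplified Colombeau algebra `𝒢(Ω) = ℱ(C^∞(Ω)) / 𝒩(C^∞(Ω))`. -/
abbrev G (Ω : Opens (Sp d)) : Type := Moderate Ω ⧸ Negligible Ω

/-- Restriction `C^∞(Ω) → C^∞(Ω')` for `Ω' ⊆ Ω`. -/
noncomputable def Smooth.restrict {Ω Ω' : Opens (Sp d)} (h : Ω' ≤ Ω) (f : Smooth Ω) : Smooth Ω' :=
  ⟨fun x => f.1 ⟨x, h x.2⟩, (f.contDiffOn.mono h).congr fun x hx => by
    rw [ext_apply _ hx, ext_apply _ (h hx)]⟩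

theorem seminorm_restrict {Ω Ω' : Opens (Sp d)} (h : Ω' ≤ Ω) {K : Set (Sp d)} (hK : K ⊆ Ω')
    (l : ℕ) (f : Smooth Ω) : seminorm K l (f.restrict h) = seminorm K l f := by
  have key : ∀ k : ℕ, ∀ x ∈ K, iteratedFDeriv ℝ k (ext (f.restrict h).1) x =
      iteratedFDeriv ℝ k (ext f.1) x := by
    intro k x hx
    have : ext (f.restrict h).1 =ᶠ[𝓝 x] ext f.1 := by
      filter_upwards [Ω'.isOpen.mem_nhds (hK hx)] with y hy
      rw [ext_apply _ hy, ext_apply _ (h hy)]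
      rfl
    exact (this.iteratedFDeriv ℝ k).eq_of_nhds
  unfold seminorm
  congr 1
  ext r
  constructor
  · rintro ⟨k, hk, x, hx, rfl⟩
    exact ⟨k, hk, x, hx, by rw [key k x hx]⟩
  · rintro ⟨k, hk, x, hx, rfl⟩
    exact ⟨k, hk, x, hx, by rw [key k x hx]⟩

/-- Restriction of moderate nets. -/
noncomputable def Moderate.restrict {Ω Ω' : Opens (Sp d)} (h : Ω' ≤ Ω) :
    Moderate Ω →+* Moderate Ω' where
  toFun f := ⟨fun ε => (f.1 ε).restrict h, fun l K hK hKΩ => by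
    obtain ⟨q, hq⟩ := f.2 l K hK (hKΩ.trans h)
    exact ⟨q, by simpa only [seminorm_restrict h hKΩ] using hq⟩⟩
  map_one' := rfl
  map_mul' _ _ := rfl
  map_zero' := rfl
  map_add' _ _ := rfl

/-- The restriction map `𝒢(Ω) → 𝒢(Ω')`, `u ↦ u|_{Ω'}`, for `Ω' ⊆ Ω`. -/
noncomputable def G.restrict {Ω Ω' : Opens (Sp d)} (h : Ω' ≤ Ω) : G Ω →+* G Ω' :=
  Ideal.quotientMap (Negligible Ω') (Moderate.restrict h) fun f hf l K hK hKΩ p => by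
    have h1 := hf l K hK (hKΩ.trans h) p
    change (fun ε : Idx => seminorm K l ((f.1 ε).restrict h)) =o[toZero] fun ε : Idx => (ε : ℝ) ^ p
    simpa only [seminorm_restrict h hKΩ] using h1

/-- The net `(f_ε)` of functions on `ℝ^d` belongs to `ℱ(C^∞(ℝ^d))`. -/
def IsModerate (f : Idx → Sp d → ℂ) : Prop :=
  ∃ h : ∀ ε, ContDiff ℝ ∞ (f ε), (fun ε => Smooth.of ⊤ (f ε) (h ε)) ∈ moderateSubalgebra (⊤ : Opens (Sp d))

/-- The class `(f_ε) + 𝒩(C^∞(ℝ^d))` in `𝒢(ℝ^d)` of a net `(f_ε) ∈ ℱ(C^∞(ℝ^d))`. -/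
noncomputable def classOf (f : Idx → Sp d → ℂ) (h : IsModerate f) : G (⊤ : Opens (Sp d)) :=
  Ideal.Quotient.mk (Negligible ⊤) ⟨fun ε => Smooth.of ⊤ (f ε) (h.fst ε), h.snd⟩

/-! ### Distributions -/

/-- Complex valued test functions `𝒟(ℝ^d)`. -/
abbrev Test (d : ℕ) : Type := 𝓓((⊤ : Opens (Sp d)), ℂ)

/-- Distributions `𝒟'(ℝ^d)`: the continuous complex linear forms on `𝒟(ℝ^d)`. -/
abbrev Distr (d : ℕ) : Type := Test d →L[ℂ] ℂ

/-- The test function `x ↦ φ (y - x)`. -/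
noncomputable def Test.flip (φ : Test d) (y : Sp d) : Test d where
  toFun x := φ (y - x)
  contDiff' := φ.contDiff.comp (contDiff_const.sub contDiff_id)
  hasCompactSupport' := φ.hasCompactSupport.comp_homeomorph (Homeomorph.subLeft y)
  tsupport_subset' := fun _ _ => trivial

/-- The convolution `(T ∗ φ)(y) = ⟨T, x ↦ φ (y - x)⟩` of `T ∈ 𝒟'(ℝ^d)` with `φ ∈ 𝒟(ℝ^d)`. -/
noncomputable def Distr.conv (T : Distr d) (φ : Test d) (y : Sp d) : ℂ := T (φ.flip y)

/-- Compactly supported distributions `ℰ'(ℝ^d)`: the linear forms on `C^∞(ℝ^d)` that are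
continuous for the topology given by the (directed) family of seminorms `p_{K,l}`. -/
structure CDistr (d : ℕ) where
  /-- The linear form. -/
  toLin : Smooth (⊤ : Opens (Sp d)) →ₗ[ℂ] ℂ
  continuous' : ∃ (K : Set (Sp d)) (l : ℕ) (C : ℝ), IsCompact K ∧ ∀ f, ‖toLin f‖ ≤ C * seminorm K l f

/-- The smooth function `x ↦ f (y - x)`. -/
noncomputable def Smooth.flip (f : Sp d → ℂ) (hf : ContDiff ℝ ∞ f) (y : Sp d) :
    Smooth (⊤ : Opens (Sp d)) :=
  Smooth.of ⊤ (fun x => f (y - x)) (hf.comp (contDiff_const.sub contDiff_id))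

/-- The convolution `(S ∗ f)(y) = ⟨S, x ↦ f (y - x)⟩` of `S ∈ ℰ'(ℝ^d)` with `f ∈ C^∞(ℝ^d)`. -/
noncomputable def CDistr.conv (S : CDistr d) (f : Sp d → ℂ) (hf : ContDiff ℝ ∞ f) (y : Sp d) : ℂ :=
  S.toLin (Smooth.flip f hf y)

theorem Smooth.contDiff_ext (f : Smooth (⊤ : Opens (Sp d))) : ContDiff ℝ ∞ (ext f.1) := by
  have := f.contDiffOn
  rwa [Opens.coe_top, contDiffOn_univ] at this

/-- A real valued test function, as a complex valued smooth function. -/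
noncomputable def cutoff (ψ : 𝓓((⊤ : Opens (Sp d)), ℝ)) : Smooth (⊤ : Opens (Sp d)) :=
  Smooth.of ⊤ (fun x => (ψ x : ℂ)) (Complex.ofRealCLM.contDiff.comp ψ.contDiff)

theorem ext_cutoff_mul (ψ : 𝓓((⊤ : Opens (Sp d)), ℝ)) (f : Smooth (⊤ : Opens (Sp d))) :
    ext (cutoff ψ * f).1 = fun x => (ψ x : ℂ) * f.1 ⟨x, trivial⟩ := by
  funext x
  rw [ext_apply _ (show x ∈ (⊤ : Opens (Sp d)) from trivial)]
  rfl

/-- The test function `ψ f ∈ 𝒟(ℝ^d)`, for `ψ ∈ 𝒟(ℝ^d)` and `f ∈ C^∞(ℝ^d)`. -/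
noncomputable def mulTest (ψ : 𝓓((⊤ : Opens (Sp d)), ℝ)) (f : Smooth (⊤ : Opens (Sp d))) :
    Test d where
  toFun x := ψ x * f.1 ⟨x, trivial⟩
  contDiff' := by
    have h := (cutoff ψ * f).contDiff_ext
    exact ext_cutoff_mul ψ f ▸ h
  hasCompactSupport' := by
    refine HasCompactSupport.intro ψ.hasCompactSupport fun x hx => ?_
    have : ψ x = 0 := image_eq_zero_of_notMem_tsupport hx
    simp [this]
  tsupport_subset' := fun _ _ => trivial

/-- A distribution is bounded by finitely many derivatives on the test functions that are supported
in a fixed compact set. -/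
theorem Distr.exists_bound (T : Distr d) (K : Compacts (Sp d)) :
    ∃ (l : ℕ) (C : ℝ), 0 ≤ C ∧ ∀ φ : Test d, (∀ x ∉ K, φ x = 0) → ∀ M : ℝ, 0 ≤ M →
      (∀ k ≤ l, ∀ x, ‖iteratedFDeriv ℝ k φ x‖ ≤ M) → ‖T φ‖ ≤ C * M := by
  let L : 𝓓_{K}(Sp d, ℂ) →L[ℂ] ℂ :=
    T.comp (TestFunction.ofSupportedInCLM ℂ (fun _ _ => trivial))
  obtain ⟨s, C, _, hC⟩ := Seminorm.bound_of_continuous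
    (ContDiffMapSupportedIn.withSeminorms ℂ (Sp d) ℂ ⊤ K) ((normSeminorm ℂ ℂ).comp L.toLinearMap)
    L.continuous.norm
  refine ⟨s.sup id, C, C.2, fun φ hφ M hM hb => ?_⟩
  let φ' : 𝓓_{K}(Sp d, ℂ) := ⟨φ, φ.contDiff, fun x hx => hφ x hx⟩
  have h1 : ‖T φ‖ ≤ C * (s.sup (ContDiffMapSupportedIn.seminorm ℂ (Sp d) ℂ ⊤ K)) φ' := hC φ'
  refine h1.trans (mul_le_mul_of_nonneg_left ?_ C.2)
  refine Seminorm.finset_sup_apply_le hM fun k hk => ?_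
  rw [ContDiffMapSupportedIn.seminorm_top_le_iff ℂ hM]
  exact fun x _ => hb k (Finset.le_sup (f := id) hk) x

/-- The product `ψ T ∈ ℰ'(ℝ^d)` of `T ∈ 𝒟'(ℝ^d)` with `ψ ∈ 𝒟(ℝ^d)`: `⟨ψ T, f⟩ = ⟨T, ψ f⟩`. -/
noncomputable def Distr.cut (ψ : 𝓓((⊤ : Opens (Sp d)), ℝ)) (T : Distr d) : CDistr d where
  toLin :=
    { toFun := fun f => T (mulTest ψ f)
      map_add' := by
        intro f g
        rw [← map_add]
        congr 1
        ext x
        change (ψ x : ℂ) * (f.1 _ + g.1 _) = (ψ x : ℂ) * f.1 _ + (ψ x : ℂ) * g.1 _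
        ring
      map_smul' := by
        intro c f
        rw [RingHom.id_apply, ← map_smul]
        congr 1
        ext x
        change (ψ x : ℂ) * (c * f.1 _) = c * ((ψ x : ℂ) * f.1 _)
        ring }
  continuous' := by
    have hK : IsCompact (tsupport ψ) := ψ.hasCompactSupport
    obtain ⟨l, C, hC, hb⟩ := T.exists_bound ⟨tsupport ψ, hK⟩
    refine ⟨tsupport ψ, l, C * (2 ^ l * seminorm (tsupport ψ) l (cutoff ψ)), hK, fun f => ?_⟩
    have e : (mulTest ψ f : Sp d → ℂ) = ext (cutoff ψ * f).1 := (ext_cutoff_mul ψ f).symm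
    have hz : ∀ x ∉ tsupport ψ, mulTest ψ f x = 0 := by
      intro x hx
      change (ψ x : ℂ) * _ = 0
      rw [image_eq_zero_of_notMem_tsupport hx, Complex.ofReal_zero, zero_mul]
    have h1 := hb (mulTest ψ f) hz (seminorm (tsupport ψ) l (cutoff ψ * f)) (seminorm_nonneg _) (by
      intro k hk x
      by_cases hx : x ∈ tsupport ψ
      · rw [e]
        exact le_seminorm hK (Set.subset_univ _) _ hk hx
      · have h0 : (mulTest ψ f : Sp d → ℂ) =ᶠ[𝓝 x] fun _ => 0 := by
          filter_upwards [(isClosed_tsupport ψ).isOpen_compl.mem_nhds hx] with y hy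
          exact hz y hy
        rw [(h0.iteratedFDeriv ℝ k).eq_of_nhds, iteratedFDeriv_fun_zero]
        simpa using seminorm_nonneg _)
    refine h1.trans ?_
    rw [mul_assoc, mul_assoc]
    exact mul_le_mul_of_nonneg_left (seminorm_mul_le hK (Set.subset_univ _) _ _) hC

/-! ### The mollifiers -/

/-- The conditions on the mollifier `ρ ∈ 𝒮(ℝ^d)`: it is even, has integral one and all its moments
of positive order vanish. -/
structure IsMollifier (ρ : 𝓢(Sp d, ℂ)) : Prop where
  even : ∀ x, ρ (-x) = ρ x
  integral_eq_one : ∫ x, ρ x = 1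
  moment_eq_zero : ∀ m : Fin d → ℕ, m ≠ 0 → ∫ x : Sp d, ((∏ i, x i ^ m i : ℝ) : ℂ) * ρ x = 0

/-- The conditions on the cutoff `χ ∈ 𝒟(ℝ^d)`. -/
structure IsCutoff (χ : 𝓓((⊤ : Opens (Sp d)), ℝ)) : Prop where
  nonneg : ∀ x, 0 ≤ χ x
  le_one : ∀ x, χ x ≤ 1
  eq_one : ∀ x ∈ Metric.closedBall (0 : Sp d) 1, χ x = 1
  eq_zero : ∀ x ∉ Metric.ball (0 : Sp d) 2, χ x = 0

/-- `ρ_ε(x) = ε^{-d} ρ(x / ε)`. -/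
noncomputable def rhoEps (ρ : 𝓢(Sp d, ℂ)) (ε : Idx) (x : Sp d) : ℂ :=
  (((ε : ℝ) ^ d)⁻¹ : ℝ) * ρ ((ε : ℝ)⁻¹ • x)

theorem contDiff_rhoEps (ρ : 𝓢(Sp d, ℂ)) (ε : Idx) : ContDiff ℝ ∞ (rhoEps ρ ε) :=
  contDiff_const.mul ((ρ.smooth ⊤).comp (contDiff_const_smul _))

/-- `θ_ε(x) = ρ_ε(x) χ(x |ln ε|)`, a test function for `ε ∈ (0,1)`. -/
noncomputable def thetaEps (ρ : 𝓢(Sp d, ℂ)) (χ : 𝓓((⊤ : Opens (Sp d)), ℝ)) (ε : Idx)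
    (hε : (ε : ℝ) < 1) : Test d where
  toFun x := rhoEps ρ ε x * (χ (|Real.log ε| • x) : ℂ)
  contDiff' := (contDiff_rhoEps ρ ε).mul
    (Complex.ofRealCLM.contDiff.comp (χ.contDiff.comp (contDiff_const_smul _)))
  hasCompactSupport' := by
    have h0 : |Real.log ε| ≠ 0 := abs_ne_zero.2 (Real.log_neg ε.2.1 hε).ne
    have h1 : HasCompactSupport fun x : Sp d => χ (|Real.log ε| • x) :=
      χ.hasCompactSupport.comp_homeomorph (Homeomorph.smulOfNeZero _ h0)
    have h2 : HasCompactSupport fun x : Sp d => (χ (|Real.log ε| • x) : ℂ) :=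
      h1.comp_left (g := fun r : ℝ => (r : ℂ)) Complex.ofReal_zero
    exact h2.mul_left
  tsupport_subset' := fun _ _ => trivial

/-- The net `(S ∗ ρ_ε)`, for `S ∈ ℰ'(ℝ^d)`. -/
noncomputable def netZero (ρ : 𝓢(Sp d, ℂ)) (S : CDistr d) (ε : Idx) : Sp d → ℂ :=
  S.conv (rhoEps ρ ε) (contDiff_rhoEps ρ ε)

open Classical in
/-- The net `(T ∗ θ_ε)`, for `T ∈ 𝒟'(ℝ^d)`. A class in `𝒢(ℝ^d)` does not depend on the value of the
net at `ε = 1`, where the convolution makes no sense in general; this value is set to `0`. -/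
noncomputable def netS (ρ : 𝓢(Sp d, ℂ)) (χ : 𝓓((⊤ : Opens (Sp d)), ℝ)) (T : Distr d) (ε : Idx) :
    Sp d → ℂ :=
  if hε : (ε : ℝ) < 1 then T.conv (thetaEps ρ χ ε hε) else 0

/-! ### The embeddings -/

/-- `ι_0 : ℰ'(ℝ^d) → 𝒢(ℝ^d)`, `S ↦ (S ∗ ρ_ε) + 𝒩(C^∞(ℝ^d))`. -/
noncomputable def iotaZero (ρ : 𝓢(Sp d, ℂ)) (h : ∀ S, IsModerate (netZero ρ S)) (S : CDistr d) :
    G (⊤ : Opens (Sp d)) :=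
  classOf (netZero ρ S) (h S)

/-- `ι_S : 𝒟'(ℝ^d) → 𝒢(ℝ^d)`, `T ↦ (T ∗ θ_ε) + 𝒩(C^∞(ℝ^d))`. -/
noncomputable def iotaS (ρ : 𝓢(Sp d, ℂ)) (χ : 𝓓((⊤ : Opens (Sp d)), ℝ))
    (h : ∀ T, IsModerate (netS ρ χ T)) (T : Distr d) : G (⊤ : Opens (Sp d)) :=
  classOf (netS ρ χ T) (h T)

/-- The conditions on the covering `(Ω_i)` and the cutoffs `(ψ_i)` of the local construction. -/
structure IsCutoffCover {Λ : Type*} (Ω : Λ → Opens (Sp d)) (ψ : Λ → 𝓓((⊤ : Opens (Sp d)), ℝ)) :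
    Prop where
  cover : ⋃ i, (Ω i : Set (Sp d)) = Set.univ
  locallyFinite : LocallyFinite fun i => (Ω i : Set (Sp d))
  isCompact_closure : ∀ i, IsCompact (closure (Ω i : Set (Sp d)))
  nonneg : ∀ i x, 0 ≤ ψ i x
  le_one : ∀ i x, ψ i x ≤ 1
  eq_one : ∀ i, ∀ᶠ x in 𝓝ˢ (closure (Ω i : Set (Sp d))), ψ i x = 1

/-- `ι_i : 𝒟'(ℝ^d) → 𝒢(Ω_i)`, `T ↦ ι_0(ψ_i T)|_{Ω_i}`. -/
noncomputable def iotaLocal (ρ : 𝓢(Sp d, ℂ)) (h : ∀ S, IsModerate (netZero ρ S))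
    (Ωi : Opens (Sp d)) (ψi : 𝓓((⊤ : Opens (Sp d)), ℝ)) (T : Distr d) : G Ωi :=
  G.restrict le_top (iotaZero ρ h (T.cut ψi))

/-- `ι` is obtained by gluing together the local maps: `ι(T)|_{Ω_i} = ι_i(T)` for all `i`, `T`. -/
def IsGluing (ρ : 𝓢(Sp d, ℂ)) (h : ∀ S, IsModerate (netZero ρ S)) {Λ : Type*}
    (Ω : Λ → Opens (Sp d)) (ψ : Λ → 𝓓((⊤ : Opens (Sp d)), ℝ))
    (ι : Distr d → G (⊤ : Opens (Sp d))) : Prop :=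
  ∀ i T, G.restrict le_top (ι T) = iotaLocal ρ h (Ω i) (ψ i) T

end Colombeau

/-! `θ_ε` vanishes where `|x||ln ε| ≥ 2`, so `T ∗ θ_ε` at `y` sees `T` only in a ball of radius
`2/|ln ε|` about `y`. Locally, and for small `ε`, it therefore equals `(ψ T) ∗ θ_ε` for any cutoff
`ψ` that is one nearby (`netS_eq_cut_conv`). This reduces everything to compactly supported
distributions, for which `CDistr.ConvBound.norm_iteratedFDeriv_conv_le` bounds all derivatives of `S
∗ f` by finitely many derivatives of `f`. Moderateness of both nets follows from the crude scaling
bounds for `ρ_ε` and `θ_ε`.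

On a compact subset of `Ω_λ` the two nets differ by `(ψ_λ T) ∗ (ρ_ε - θ_ε)`. The kernel `ρ_ε - θ_ε =
ρ_ε (1 - χ(·|ln ε|))` lives where `|x||ln ε| ≥ 1`. There the rapid decay of `ρ` yields arbitrarily
high powers of `ε`, at the price of powers of `|ln ε|`, which are harmless because `|ln ε|² ε` is
bounded. So the kernel is `O(ε^p)` with all derivatives, uniformly in `x`, for every `p`
(`exists_norm_iteratedFDeriv_rhoEps_sub_thetaFun_le`), and the difference is negligible
(`isGluing_iotaS`).

Hence `ι_S` itself has the property defining `ι_A`, which gives existence without gluing local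
sections. Uniqueness is the fact that an element of `𝒢` is determined by its restrictions to an open
cover (`G.eq_of_restrict_eq`). -/

namespace Colombeau

variable {d : ℕ}

/-! ### Directional derivatives -/

/-- The directional derivative `∂_v f`. -/
noncomputable def dirDeriv (f : Sp d → ℂ) (v : Sp d) (x : Sp d) : ℂ := fderiv ℝ f x v

theorem contDiff_dirDeriv {f : Sp d → ℂ} (hf : ContDiff ℝ ∞ f) (v : Sp d) :
    ContDiff ℝ ∞ (dirDeriv f v) :=
  (contDiff_infty_iff_fderiv.1 hf).2.clm_apply contDiff_const

theorem contDiff_iteratedFDeriv {f : Sp d → ℂ} (hf : ContDiff ℝ ∞ f) (k : ℕ) :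
    ContDiff ℝ ∞ (iteratedFDeriv ℝ k f) :=
  hf.iteratedFDeriv_right (m := ∞) (i := k) (by exact_mod_cast le_top)

theorem norm_iteratedFDeriv_dirDeriv_le {f : Sp d → ℂ} (hf : ContDiff ℝ ∞ f) (v : Sp d) (k : ℕ)
    (x : Sp d) : ‖iteratedFDeriv ℝ k (dirDeriv f v) x‖ ≤ ‖v‖ * ‖iteratedFDeriv ℝ (k + 1) f x‖ := by
  rw [← norm_iteratedFDeriv_fderiv]
  exact norm_iteratedFDeriv_clm_apply_const
    (contDiff_infty_iff_fderiv.1 hf).2.contDiffAt (mod_cast le_top)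

/-- By symmetry of second derivatives, `v` can be moved past the other slots one at a time. This
identifies the linear part of `D^k f(z + h) - D^k f(z)` with `D^k` of a single function `∂_h f`, to
which a distribution can be applied. -/
theorem iteratedFDeriv_dirDeriv {f : Sp d → ℂ} (hf : ContDiff ℝ ∞ f) (v : Sp d) (k : ℕ) :
    iteratedFDeriv ℝ k (dirDeriv f v) = fun x => fderiv ℝ (iteratedFDeriv ℝ k f) x v := by
  induction k with
  | zero =>
    funext x
    ext m
    rw [iteratedFDeriv_zero_apply, iteratedFDeriv_zero_eq_comp, LinearIsometryEquiv.comp_fderiv]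
    rfl
  | succ k ih =>
    funext x
    ext m
    have hG := contDiff_iteratedFDeriv hf k
    have hG' := (contDiff_infty_iff_fderiv.1 hG).2
    have hd : DifferentiableAt ℝ (fderiv ℝ (iteratedFDeriv ℝ k f)) x :=
      (hG'.differentiable (by simp)) x
    have hs : IsSymmSndFDerivAt ℝ (iteratedFDeriv ℝ k f) x :=
      hG.contDiffAt.isSymmSndFDerivAt (by
        rw [minSmoothness_of_isRCLikeNormedField]
        exact WithTop.coe_le_coe.2 le_top)
    have h1 := (((contDiff_infty_iff_fderiv.1 (contDiff_iteratedFDeriv hf (k + 1))).1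
      x).hasFDerivAt.continuousMultilinear_apply_const m)
    have h2 := (hd.hasFDerivAt.clm_apply (hasFDerivAt_const (m 0)
      x)).continuousMultilinear_apply_const (Fin.tail m)
    have he' : fderiv ℝ (iteratedFDeriv ℝ (k + 1) f) x v m =
        fderiv ℝ (fderiv ℝ (iteratedFDeriv ℝ k f)) x v (m 0) (Fin.tail m) := by
      simpa using congrArg (fun L => L v) (h1.unique h2)
    rw [iteratedFDeriv_succ_apply_left, ih, fderiv_clm_apply hd (differentiableAt_const v), he',
      hs v (m 0)]
    simp

theorem exists_uniform_remainder_le {f : Sp d → ℂ} (hf : ContDiff ℝ ∞ f) (k : ℕ) {K : Set (Sp d)}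
    (hK : IsCompact K) {c : ℝ} (hc : 0 < c) :
    ∀ᶠ h in 𝓝 (0 : Sp d), ∀ z ∈ K, ‖iteratedFDeriv ℝ k f (z + h) - iteratedFDeriv ℝ k f z -
      iteratedFDeriv ℝ k (dirDeriv f h) z‖ ≤ c * ‖h‖ := by
  have hG := contDiff_iteratedFDeriv hf k
  have hG' := (contDiff_infty_iff_fderiv.1 hG)
  -- Only the base point has to lie in `K`; the nearby point `z + h` may leave it. The mean value
  -- inequality on the ball about `z` then bounds the remainder uniformly in `z`.
  have hu := hK.uniformContinuousAt_of_continuousAt (fderiv ℝ (iteratedFDeriv ℝ k f))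
    (fun a _ => hG'.2.continuous.continuousAt) (Metric.dist_mem_uniformity (α := Sp d →L[ℝ] Sp d [×k]→L[ℝ] ℂ) hc)
  obtain ⟨δ, hδ, hδ'⟩ := Metric.mem_uniformity_dist.1 hu
  filter_upwards [Metric.ball_mem_nhds (0 : Sp d) hδ] with h hh z hz
  rw [iteratedFDeriv_dirDeriv hf]
  have := (convex_ball z δ).norm_image_sub_le_of_norm_hasFDerivWithin_le' (C := c)
    (φ := fderiv ℝ (iteratedFDeriv ℝ k f) z)
    (fun w _ => ((hG'.1 w).hasFDerivAt).hasFDerivWithinAt) (fun w hw => ?_)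
    (Metric.mem_ball_self hδ) (y := z + h) (by simpa using hh)
  · simpa using this
  · have := hδ' (a := z) (b := w) (by rw [dist_comm]; exact hw) hz
    rw [← dist_eq_norm, dist_comm]
    exact this.le

/-! ### Convolution with compactly supported distributions -/

theorem ext_of (f : Sp d → ℂ) (hf : ContDiff ℝ ∞ f) :
    ext (Smooth.of (⊤ : Opens (Sp d)) f hf).1 = f := by
  funext x
  exact ext_apply _ (show x ∈ (⊤ : Opens (Sp d)) from trivial)

theorem norm_iteratedFDeriv_comp_sub_left {F : Type*} [NormedAddCommGroup F] [NormedSpace ℝ F]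
    (f : Sp d → F) (y : Sp d) (k : ℕ) (x : Sp d) :
    ‖iteratedFDeriv ℝ k (fun x => f (y - x)) x‖ = ‖iteratedFDeriv ℝ k f (y - x)‖ := by
  have h := (LinearIsometryEquiv.neg ℝ (E := Sp d)).norm_iteratedFDeriv_comp_right
    (fun z => f (y + z)) x k
  rw [iteratedFDeriv_comp_add_left] at h
  have e1 : (fun z => f (y + z)) ∘ (LinearIsometryEquiv.neg ℝ (E := Sp d)) =
      fun x => f (y - x) := by
    funext z
    simp [sub_eq_add_neg]
  rw [e1] at h
  simpa [sub_eq_add_neg] using h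

/-- `S` is bounded by `C` times the seminorm `p_{K,l}`, in terms of convolutions. -/
def CDistr.ConvBound (S : CDistr d) (K : Set (Sp d)) (l : ℕ) (C : ℝ) : Prop :=
  ∀ (f : Sp d → ℂ) (hf : ContDiff ℝ ∞ f) (y : Sp d) (M : ℝ), 0 ≤ M →
    (∀ k ≤ l, ∀ x ∈ K, ‖iteratedFDeriv ℝ k f (y - x)‖ ≤ M) → ‖S.conv f hf y‖ ≤ C * M

theorem CDistr.exists_convBound (S : CDistr d) :
    ∃ (K : Set (Sp d)) (l : ℕ) (C : ℝ), IsCompact K ∧ 0 ≤ C ∧ S.ConvBound K l C := by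
  obtain ⟨K, l, C, hK, h⟩ := S.continuous'
  -- The constant in `continuous'` carries no sign condition.
  refine ⟨K, l, |C|, hK, abs_nonneg C, fun f hf y M hM hfM => (h _).trans ?_⟩
  refine mul_le_mul (le_abs_self C) (seminorm_le hM fun k hk x hx => ?_) (seminorm_nonneg _)
    (abs_nonneg C)
  rw [Smooth.flip, ext_of, norm_iteratedFDeriv_comp_sub_left]
  exact hfM k hk x hx

theorem CDistr.conv_add (S : CDistr d) {f g : Sp d → ℂ} (hf : ContDiff ℝ ∞ f)
    (hg : ContDiff ℝ ∞ g) (y : Sp d) :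
    S.conv (fun x => f x + g x) (hf.add hg) y = S.conv f hf y + S.conv g hg y :=
  S.toLin.map_add (Smooth.flip f hf y) (Smooth.flip g hg y)

theorem CDistr.conv_sub (S : CDistr d) {f g : Sp d → ℂ} (hf : ContDiff ℝ ∞ f)
    (hg : ContDiff ℝ ∞ g) (y : Sp d) :
    S.conv (fun x => f x - g x) (hf.sub hg) y = S.conv f hf y - S.conv g hg y :=
  S.toLin.map_sub (Smooth.flip f hf y) (Smooth.flip g hg y)

theorem CDistr.conv_const_mul (S : CDistr d) {f : Sp d → ℂ} (hf : ContDiff ℝ ∞ f) (c : ℂ)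
    (y : Sp d) : S.conv (fun x => c * f x) (contDiff_const.mul hf) y = c * S.conv f hf y :=
  S.toLin.map_smul c (Smooth.flip f hf y)

theorem CDistr.conv_comp_add (S : CDistr d) {f : Sp d → ℂ} (hf : ContDiff ℝ ∞ f) (h y : Sp d) :
    S.conv (fun x => f (x + h)) (hf.comp (contDiff_id.add contDiff_const)) y =
      S.conv f hf (y + h) := by
  unfold CDistr.conv Smooth.flip
  congr 2
  funext x
  exact congrArg f (by abel)

theorem CDistr.conv_congr (S : CDistr d) {f g : Sp d → ℂ} (h : f = g) (hf : ContDiff ℝ ∞ f)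
    (hg : ContDiff ℝ ∞ g) : S.conv f hf = S.conv g hg := by
  subst h
  rfl

/-- The differential `v ↦ S ∗ ∂_v f` of `S ∗ f`. -/
noncomputable def CDistr.convDeriv (S : CDistr d) (f : Sp d → ℂ) (hf : ContDiff ℝ ∞ f)
    (y : Sp d) : Sp d →L[ℝ] ℂ :=
  LinearMap.toContinuousLinearMap
    { toFun := fun v => S.conv (dirDeriv f v) (contDiff_dirDeriv hf v) y
      map_add' := by
        intro v w
        rw [← S.conv_add]
        refine congrFun (S.conv_congr ?_ _ _) y
        funext x
        exact map_add _ _ _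
      map_smul' := by
        intro c v
        rw [RingHom.id_apply, Complex.real_smul, ← S.conv_const_mul]
        refine congrFun (S.conv_congr ?_ _ _) y
        funext x
        simp [dirDeriv] }

/-- The remainder `f(· + h) - f - ∂_h f` is `o(h)` in the `C^l` seminorm over the compact set `y -
K`, and the continuity of `S` transfers this to the convolutions. -/
theorem CDistr.hasFDerivAt_conv (S : CDistr d) (f : Sp d → ℂ) (hf : ContDiff ℝ ∞ f) (y : Sp d) :
    HasFDerivAt (S.conv f hf) (S.convDeriv f hf y) y := by
  obtain ⟨K, l, C, hK, hC, hb⟩ := S.exists_convBound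
  rw [hasFDerivAt_iff_isLittleO_nhds_zero, isLittleO_iff]
  intro c hc
  have hK' : IsCompact ((fun x => y - x) '' K) := hK.image (by fun_prop)
  -- `C` may be zero, hence the division by `C + 1`; `C * (c / (C + 1)) ≤ c` suffices at the end.
  have hc' : 0 < c / (C + 1) := by positivity
  have hev : ∀ᶠ h in 𝓝 (0 : Sp d), ∀ k ∈ Finset.range (l + 1), ∀ z ∈ (fun x => y - x) '' K,
      ‖iteratedFDeriv ℝ k f (z + h) - iteratedFDeriv ℝ k f z -
      iteratedFDeriv ℝ k (dirDeriv f h) z‖ ≤ c / (C + 1) * ‖h‖ :=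
    (Finset.eventually_all _).2 fun k _ => exists_uniform_remainder_le hf k hK' hc'
  filter_upwards [hev] with h hh
  have hfh : ContDiff ℝ ∞ fun x => f (x + h) := hf.comp (contDiff_id.add contDiff_const)
  have hdd := contDiff_dirDeriv hf h
  have key := hb (fun x => (f (x + h) - f x) - dirDeriv f h x) ((hfh.sub hf).sub hdd) y
    (c / (C + 1) * ‖h‖) (by positivity) fun k hk x hx => by
      have := hh k (Finset.mem_range.2 (Nat.lt_succ_of_le hk)) _ ⟨x, hx, rfl⟩
      have hle : (k : WithTop ℕ∞) ≤ ∞ := mod_cast le_top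
      have e1 : iteratedFDeriv ℝ k (fun x => (f (x + h) - f x) - dirDeriv f h x) (y - x) =
          iteratedFDeriv ℝ k f (y - x + h) - iteratedFDeriv ℝ k f (y - x) -
            iteratedFDeriv ℝ k (dirDeriv f h) (y - x) := by
        rw [← iteratedFDeriv_comp_add_right, ← fun_iteratedFDeriv_sub_apply
          (hfh.of_le hle).contDiffAt (hf.of_le hle).contDiffAt, ← fun_iteratedFDeriv_sub_apply
          ((hfh.sub hf).of_le hle).contDiffAt (hdd.of_le hle).contDiffAt]
      rw [e1]
      exact this
  rw [S.conv_sub (hfh.sub hf) hdd, S.conv_sub hfh hf, S.conv_comp_add hf] at key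
  refine key.trans ?_
  have : C * (c / (C + 1)) ≤ c := by
    rw [mul_div_assoc', div_le_iff₀ (by positivity)]
    nlinarith
  rw [← mul_assoc]
  gcongr

theorem CDistr.fderiv_conv_apply (S : CDistr d) (f : Sp d → ℂ) (hf : ContDiff ℝ ∞ f)
    (y v : Sp d) :
    fderiv ℝ (S.conv f hf) y v = S.conv (dirDeriv f v) (contDiff_dirDeriv hf v) y := by
  rw [(S.hasFDerivAt_conv f hf y).fderiv]
  rfl

theorem CDistr.contDiff_conv (S : CDistr d) (f : Sp d → ℂ) (hf : ContDiff ℝ ∞ f) :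
    ContDiff ℝ ∞ (S.conv f hf) := by
  rw [contDiff_infty]
  intro n
  induction n generalizing f with
  | zero =>
    exact contDiff_zero.2 (continuous_iff_continuousAt.2 fun y =>
      (S.hasFDerivAt_conv f hf y).continuousAt)
  | succ n ih =>
    push_cast
    rw [contDiff_succ_iff_fderiv_apply]
    refine ⟨fun y => (S.hasFDerivAt_conv f hf y).differentiableAt, by simp, fun v => ?_⟩
    rw [show (fun y => fderiv ℝ (S.conv f hf) y v) = _ from
      funext fun y => S.fderiv_conv_apply f hf y v]
    exact ih _ (contDiff_dirDeriv hf v)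

/-- Derivatives of `S ∗ f` fall on `f`, so `n` of them raise the order from `l` to `l + n` and
change neither `K` nor `C`. -/
theorem CDistr.ConvBound.norm_iteratedFDeriv_conv_le {S : CDistr d} {K : Set (Sp d)} {l : ℕ}
    {C : ℝ} (hb : S.ConvBound K l C) (n : ℕ) (f : Sp d → ℂ) (hf : ContDiff ℝ ∞ f) (y : Sp d)
    {M : ℝ} (hC : 0 ≤ C) (hM : 0 ≤ M)
    (h : ∀ k ≤ l + n, ∀ x ∈ K, ‖iteratedFDeriv ℝ k f (y - x)‖ ≤ M) :
    ‖iteratedFDeriv ℝ n (S.conv f hf) y‖ ≤ C * M := by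
  induction n generalizing f M with
  | zero =>
    rw [norm_iteratedFDeriv_zero]
    exact hb f hf y M hM h
  | succ n ih =>
    refine ContinuousMultilinearMap.opNorm_le_bound (by positivity) fun m => ?_
    have hd := (contDiff_infty_iff_fderiv.1 (S.contDiff_conv f hf)).2
    have e : iteratedFDeriv ℝ (n + 1) (S.conv f hf) y m = iteratedFDeriv ℝ n
        (S.conv (dirDeriv f (m (Fin.last n))) (contDiff_dirDeriv hf _)) y (Fin.init m) := by
      rw [iteratedFDeriv_succ_apply_right, ← iteratedFDeriv_clm_apply_const_apply
        (hd.of_le (mod_cast le_top)) le_rfl]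
      congr 2
      funext z
      exact S.fderiv_conv_apply f hf z _
    rw [e, Fin.prod_univ_castSucc]
    refine (ContinuousMultilinearMap.le_opNorm _ _).trans ?_
    -- The last vector becomes a direction of differentiation of `f`, and its norm is absorbed into
    -- `M`; this is why `f` and `M` vary in the induction.
    have := ih (dirDeriv f (m (Fin.last n))) (contDiff_dirDeriv hf _)
      (M := ‖m (Fin.last n)‖ * M) (by positivity) fun k hk x hx =>
        (norm_iteratedFDeriv_dirDeriv_le hf _ k _).trans
          (mul_le_mul_of_nonneg_left (h (k + 1) (by omega) x hx) (norm_nonneg _))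
    calc _ ≤ C * (‖m (Fin.last n)‖ * M) * ∏ i, ‖Fin.init m i‖ := by gcongr
      _ = _ := by
        simp only [Fin.init]
        ring

/-! ### Estimates for the mollifiers -/

theorem exists_uniform_of_mono {P : ℕ → ℝ → Prop} (mono : ∀ k C C', C ≤ C' → P k C → P k C')
    (h : ∀ k, ∃ C, P k C) (n : ℕ) : ∃ C, 0 ≤ C ∧ ∀ k ≤ n, P k C := by
  choose C hC using h
  refine ⟨∑ j ∈ Finset.range (n + 1), |C j|, Finset.sum_nonneg fun _ _ => abs_nonneg _,
    fun k hk => mono k _ _ ((le_abs_self _).trans ?_) (hC k)⟩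
  exact Finset.single_le_sum (f := fun j => |C j|) (fun _ _ => abs_nonneg _)
    (Finset.mem_range.2 (Nat.lt_succ_of_le hk))

theorem one_le_inv_idx (ε : Idx) : 1 ≤ (ε : ℝ)⁻¹ := (one_le_inv₀ ε.2.1).2 ε.2.2

/-- This is the square of `|ln t| t < 1` at `t = √ε`. It lets one power of `ε` pay for two
logarithms. -/
theorem abs_log_sq_mul_le (ε : Idx) : |Real.log ε| ^ 2 * ε ≤ 4 := by
  have h0 : (0 : ℝ) < ε := ε.2.1
  have h1 := Real.abs_log_mul_self_lt (√ε) (Real.sqrt_pos.2 h0) (Real.sqrt_le_one.2 ε.2.2)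
  rw [Real.log_sqrt h0.le, abs_mul, abs_div, abs_two, abs_of_nonneg (Real.sqrt_nonneg _)] at h1
  have h2 : 0 ≤ |Real.log ε| / 2 * √ε := by positivity
  have h3 : (|Real.log ε| / 2 * √ε) ^ 2 ≤ 1 := pow_le_one₀ h2 h1.le
  rw [mul_pow, Real.sq_sqrt h0.le, div_pow] at h3
  linarith

theorem abs_log_le_inv (ε : Idx) : |Real.log ε| ≤ (ε : ℝ)⁻¹ := by
  have h0 : (0 : ℝ) < ε := ε.2.1
  have h1 := Real.abs_log_mul_self_lt ε h0 ε.2.2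
  rw [abs_mul, abs_of_pos h0] at h1
  rw [← one_div, le_div_iff₀ h0]
  exact h1.le

theorem norm_iteratedFDeriv_rhoEps (ρ : 𝓢(Sp d, ℂ)) (ε : Idx) (k : ℕ) (x : Sp d) :
    ‖iteratedFDeriv ℝ k (rhoEps ρ ε) x‖ =
      (ε : ℝ)⁻¹ ^ (d + k) * ‖iteratedFDeriv ℝ k ρ ((ε : ℝ)⁻¹ • x)‖ := by
  have h0 : (0 : ℝ) < ε := ε.2.1
  have hk : ContDiff ℝ k ρ := ρ.smooth k
  have e : rhoEps ρ ε = fun x => ((ε : ℝ) ^ d)⁻¹ • ρ ((ε : ℝ)⁻¹ • x) := by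
    funext x
    rw [Complex.real_smul]
    rfl
  have hc : ContDiffAt ℝ k (fun x => ρ ((ε : ℝ)⁻¹ • x)) x :=
    (hk.comp (contDiff_const_smul _)).contDiffAt
  rw [e, iteratedFDeriv_const_smul_apply' hc,
    iteratedFDeriv_comp_const_smul _ hk, norm_smul, norm_smul, Real.norm_of_nonneg (by positivity),
    Real.norm_of_nonneg (by positivity), pow_add, inv_pow, inv_pow, mul_assoc]

/-- Rescale the Schwartz bound for `ρ` to `x / ε`: the weight gains `ε^N`, while the normalisation
and the derivatives cost at most `ε^{-(d+n)}`. -/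
theorem exists_pow_mul_norm_iteratedFDeriv_rhoEps_le (ρ : 𝓢(Sp d, ℂ)) (N n : ℕ) :
    ∃ C, 0 ≤ C ∧ ∀ k ≤ n, ∀ (ε : Idx) (x : Sp d),
      ‖x‖ ^ N * ‖iteratedFDeriv ℝ k (rhoEps ρ ε) x‖ ≤ C * ((ε : ℝ) ^ N * (ε : ℝ)⁻¹ ^ (d + n)) := by
  obtain ⟨C, hC, h⟩ := exists_uniform_of_mono
    (P := fun k C => ∀ x, ‖x‖ ^ N * ‖iteratedFDeriv ℝ k ρ x‖ ≤ C)
    (fun k C C' hC h x => (h x).trans hC) (fun k => by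
      obtain ⟨C, _, h⟩ := ρ.decay N k
      exact ⟨C, h⟩) n
  refine ⟨C, hC, fun k hk ε x => ?_⟩
  have h0 : (0 : ℝ) < ε := ε.2.1
  have h1 := h k hk ((ε : ℝ)⁻¹ • x)
  rw [norm_smul, Real.norm_of_nonneg (by positivity), mul_pow] at h1
  rw [norm_iteratedFDeriv_rhoEps]
  calc ‖x‖ ^ N * ((ε : ℝ)⁻¹ ^ (d + k) * ‖iteratedFDeriv ℝ k ρ ((ε : ℝ)⁻¹ • x)‖)
      = (ε : ℝ) ^ N * (ε : ℝ)⁻¹ ^ (d + k) *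
        ((ε : ℝ)⁻¹ ^ N * ‖x‖ ^ N * ‖iteratedFDeriv ℝ k ρ ((ε : ℝ)⁻¹ • x)‖) := by
        have h2 : (ε : ℝ) ^ N * (ε : ℝ)⁻¹ ^ N = 1 := by
          rw [← mul_pow, mul_inv_cancel₀ h0.ne', one_pow]
        linear_combination (-(‖x‖ ^ N * ((ε : ℝ)⁻¹ ^ (d + k) *
          ‖iteratedFDeriv ℝ k ρ ((ε : ℝ)⁻¹ • x)‖))) * h2
    _ ≤ (ε : ℝ) ^ N * (ε : ℝ)⁻¹ ^ (d + n) * C := by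
        gcongr
        exact one_le_inv_idx ε
    _ = _ := mul_comm _ _

theorem exists_norm_iteratedFDeriv_rhoEps_le (ρ : 𝓢(Sp d, ℂ)) (n : ℕ) :
    ∃ C, 0 ≤ C ∧ ∀ k ≤ n, ∀ (ε : Idx) (x : Sp d),
      ‖iteratedFDeriv ℝ k (rhoEps ρ ε) x‖ ≤ C * (ε : ℝ)⁻¹ ^ (d + n) := by
  simpa using exists_pow_mul_norm_iteratedFDeriv_rhoEps_le ρ 0 n

/-- The scaled cutoff `x ↦ χ (x |ln ε|)`. -/
noncomputable def chiEps (χ : 𝓓((⊤ : Opens (Sp d)), ℝ)) (ε : Idx) (x : Sp d) : ℂ :=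
  (χ (|Real.log ε| • x) : ℂ)

theorem contDiff_coe_test (χ : 𝓓((⊤ : Opens (Sp d)), ℝ)) :
    ContDiff ℝ ∞ fun x => (χ x : ℂ) :=
  Complex.ofRealCLM.contDiff.comp χ.contDiff

theorem contDiff_chiEps (χ : 𝓓((⊤ : Opens (Sp d)), ℝ)) (ε : Idx) : ContDiff ℝ ∞ (chiEps χ ε) :=
  (contDiff_coe_test χ).comp (contDiff_const_smul _)

/-- Each derivative produces a factor `|ln ε| ≤ ε⁻¹`. This crude bound is enough, since a fixed
number of negative powers of `ε` does no harm later. -/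
theorem exists_norm_iteratedFDeriv_chiEps_le (χ : 𝓓((⊤ : Opens (Sp d)), ℝ)) (n : ℕ) :
    ∃ C, 0 ≤ C ∧ ∀ k ≤ n, ∀ (ε : Idx) (x : Sp d),
      ‖iteratedFDeriv ℝ k (chiEps χ ε) x‖ ≤ C * (ε : ℝ)⁻¹ ^ n := by
  have hc : HasCompactSupport fun x => (χ x : ℂ) :=
    χ.hasCompactSupport.comp_left (g := fun r : ℝ => (r : ℂ)) Complex.ofReal_zero
  obtain ⟨C, hC, h⟩ := exists_uniform_of_mono
    (P := fun k C => ∀ x, ‖iteratedFDeriv ℝ k (fun x => (χ x : ℂ)) x‖ ≤ C)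
    (fun k C C' hC h x => (h x).trans hC) (fun k =>
      (hc.iteratedFDeriv k).exists_bound_of_continuous
        (contDiff_iteratedFDeriv (contDiff_coe_test χ) k).continuous) n
  refine ⟨C, hC, fun k hk ε x => ?_⟩
  have e : iteratedFDeriv ℝ k (chiEps χ ε) x = _ := congrFun (iteratedFDeriv_comp_const_smul
    |Real.log ε| ((contDiff_coe_test χ).of_le (WithTop.coe_le_coe.2 le_top))) x
  rw [e, norm_smul, norm_pow, Real.norm_eq_abs, abs_abs, mul_comm]
  gcongr
  · exact h k hk _
  · exact (pow_le_pow_left₀ (abs_nonneg _) (abs_log_le_inv ε) k).trans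
      (pow_le_pow_right₀ (one_le_inv_idx ε) hk)

theorem norm_iteratedFDeriv_mul_le_of_le {f g : Sp d → ℂ} (hf : ContDiff ℝ ∞ f)
    (hg : ContDiff ℝ ∞ g) {k : ℕ} {x : Sp d} {A B : ℝ} (hA : 0 ≤ A)
    (hfA : ∀ i ≤ k, ‖iteratedFDeriv ℝ i f x‖ ≤ A) (hgB : ∀ i ≤ k, ‖iteratedFDeriv ℝ i g x‖ ≤ B) :
    ‖iteratedFDeriv ℝ k (fun x => f x * g x) x‖ ≤ 2 ^ k * (A * B) := by
  refine (norm_iteratedFDeriv_mul_le hf hg x (n := k) (WithTop.coe_le_coe.2 le_top)).trans ?_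
  have h2 : (2 : ℝ) ^ k = ∑ i ∈ Finset.range (k + 1), (k.choose i : ℝ) := by
    exact_mod_cast (Nat.sum_range_choose k).symm
  rw [h2, Finset.sum_mul]
  refine Finset.sum_le_sum fun i hi => ?_
  rw [mul_assoc]
  gcongr
  · exact hfA i (Nat.lt_succ_iff.1 (Finset.mem_range.1 hi))
  · exact hgB _ (Nat.sub_le k i)

/-- The function `θ_ε = ρ_ε χ_ε`, for all `ε ∈ (0,1]`. -/
noncomputable def thetaFun (ρ : 𝓢(Sp d, ℂ)) (χ : 𝓓((⊤ : Opens (Sp d)), ℝ)) (ε : Idx)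
    (x : Sp d) : ℂ :=
  rhoEps ρ ε x * chiEps χ ε x

theorem contDiff_thetaFun (ρ : 𝓢(Sp d, ℂ)) (χ : 𝓓((⊤ : Opens (Sp d)), ℝ)) (ε : Idx) :
    ContDiff ℝ ∞ (thetaFun ρ χ ε) :=
  (contDiff_rhoEps ρ ε).mul (contDiff_chiEps χ ε)

theorem exists_norm_iteratedFDeriv_thetaFun_le (ρ : 𝓢(Sp d, ℂ)) (χ : 𝓓((⊤ : Opens (Sp d)), ℝ))
    (n : ℕ) : ∃ C, 0 ≤ C ∧ ∀ k ≤ n, ∀ (ε : Idx) (x : Sp d),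
      ‖iteratedFDeriv ℝ k (thetaFun ρ χ ε) x‖ ≤ C * (ε : ℝ)⁻¹ ^ (d + n + n) := by
  obtain ⟨A, hA, hA'⟩ := exists_norm_iteratedFDeriv_rhoEps_le ρ n
  obtain ⟨B, hB, hB'⟩ := exists_norm_iteratedFDeriv_chiEps_le χ n
  refine ⟨2 ^ n * (A * B), by positivity, fun k hk ε x => ?_⟩
  have h0 : (0 : ℝ) < ε := ε.2.1
  refine (norm_iteratedFDeriv_mul_le_of_le (contDiff_rhoEps ρ ε) (contDiff_chiEps χ ε)
    (by positivity) (fun i hi => hA' i (hi.trans hk) ε x)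
    (fun i hi => hB' i (hi.trans hk) ε x)).trans ?_
  calc (2 : ℝ) ^ k * (A * (ε : ℝ)⁻¹ ^ (d + n) * (B * (ε : ℝ)⁻¹ ^ n))
      ≤ 2 ^ n * (A * (ε : ℝ)⁻¹ ^ (d + n) * (B * (ε : ℝ)⁻¹ ^ n)) := by
        gcongr
        norm_num
    _ = _ := by ring

/-- The central estimate: `1 - χ(x|ln ε|)` removes the core `|x||ln ε| ≤ 1`, and outside it the
decay of `ρ` beats every power of `ε`. -/
theorem exists_norm_iteratedFDeriv_rhoEps_sub_thetaFun_le (ρ : 𝓢(Sp d, ℂ))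
    {χ : 𝓓((⊤ : Opens (Sp d)), ℝ)} (hχ : IsCutoff χ) (n p : ℕ) :
    ∃ C, 0 ≤ C ∧ ∀ k ≤ n, ∀ (ε : Idx) (x : Sp d),
      ‖iteratedFDeriv ℝ k (fun x => rhoEps ρ ε x - thetaFun ρ χ ε x) x‖ ≤ C * (ε : ℝ) ^ p := by
  -- With weight `|x|^{2m}` the decay yields `ε^{2m}`. Half of it absorbs `|ln ε|^{2m}`; of the
  -- other half, `d + n` powers pay for `ρ_ε`, `n` for `1 - χ_ε`, and `p` remain.
  set m : ℕ := p + (d + n + n) with hm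
  obtain ⟨A, hA, hA'⟩ := exists_pow_mul_norm_iteratedFDeriv_rhoEps_le ρ (2 * m) n
  obtain ⟨B, hB, hB'⟩ := exists_norm_iteratedFDeriv_chiEps_le χ n
  refine ⟨2 ^ n * (A * 4 ^ m * (B + 1)), by positivity, fun k hk ε x => ?_⟩
  have h0 : (0 : ℝ) < ε := ε.2.1
  have e : (fun x => rhoEps ρ ε x - thetaFun ρ χ ε x) =
      fun x => rhoEps ρ ε x * (1 - chiEps χ ε x) := by
    funext x
    unfold thetaFun
    ring
  rw [e]
  rcases lt_or_ge (|Real.log ε| * ‖x‖) 1 with hx | hx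
  -- The strict inequality is an open condition, so the product vanishes near `x` and all its
  -- derivatives vanish at `x`.
  · have hz : (fun x => rhoEps ρ ε x * (1 - chiEps χ ε x)) =ᶠ[𝓝 x] fun _ => 0 := by
      have ho : IsOpen {z : Sp d | |Real.log ε| * ‖z‖ < 1} :=
        isOpen_lt (by fun_prop) continuous_const
      filter_upwards [ho.mem_nhds hx] with z hz
      have : χ (|Real.log ε| • z) = 1 := hχ.eq_one _ (by
        rw [mem_closedBall_zero_iff, norm_smul, Real.norm_eq_abs, abs_abs]
        exact hz.le)
      simp [chiEps, this]
    rw [(hz.iteratedFDeriv ℝ k).eq_of_nhds, iteratedFDeriv_fun_zero, Pi.zero_apply, norm_zero]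
    positivity
  · have hρ : ∀ i ≤ k, ‖iteratedFDeriv ℝ i (rhoEps ρ ε) x‖ ≤
        A * (4 ^ m * (ε : ℝ) ^ m * (ε : ℝ)⁻¹ ^ (d + n)) := by
      intro i hi
      calc ‖iteratedFDeriv ℝ i (rhoEps ρ ε) x‖
          ≤ (|Real.log ε| * ‖x‖) ^ (2 * m) * ‖iteratedFDeriv ℝ i (rhoEps ρ ε) x‖ :=
            le_mul_of_one_le_left (norm_nonneg _) (one_le_pow₀ hx)
        _ = |Real.log ε| ^ (2 * m) * (‖x‖ ^ (2 * m) * ‖iteratedFDeriv ℝ i (rhoEps ρ ε) x‖) := by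
            ring
        _ ≤ |Real.log ε| ^ (2 * m) * (A * ((ε : ℝ) ^ (2 * m) * (ε : ℝ)⁻¹ ^ (d + n))) := by
            exact mul_le_mul_of_nonneg_left (hA' i (hi.trans hk) ε x) (by positivity)
        _ = A * ((|Real.log ε| ^ 2 * ε) ^ m * (ε : ℝ) ^ m * (ε : ℝ)⁻¹ ^ (d + n)) := by
            ring
        _ ≤ _ := by
            gcongr
            exact abs_log_sq_mul_le ε
    have hχ' : ∀ i ≤ k, ‖iteratedFDeriv ℝ i (fun x => 1 - chiEps χ ε x) x‖ ≤
        (B + 1) * (ε : ℝ)⁻¹ ^ n := by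
      intro i hi
      rw [fun_iteratedFDeriv_sub_apply contDiff_const.contDiffAt
        ((contDiff_chiEps χ ε).of_le (WithTop.coe_le_coe.2 le_top)).contDiffAt, add_mul, one_mul,
        add_comm]
      refine (norm_sub_le _ _).trans (add_le_add ?_ (hB' i (hi.trans hk) ε x))
      refine le_trans ?_ (one_le_pow₀ (one_le_inv_idx ε))
      cases i with
      | zero => simp
      | succ i => simp [iteratedFDeriv_const_of_ne]
    refine (norm_iteratedFDeriv_mul_le_of_le (contDiff_rhoEps ρ ε)
      (contDiff_const.sub (contDiff_chiEps χ ε)) (by positivity) hρ hχ').trans ?_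
    calc (2 : ℝ) ^ k * (A * (4 ^ m * (ε : ℝ) ^ m * (ε : ℝ)⁻¹ ^ (d + n)) *
          ((B + 1) * (ε : ℝ)⁻¹ ^ n))
        ≤ 2 ^ n * (A * (4 ^ m * (ε : ℝ) ^ m * (ε : ℝ)⁻¹ ^ (d + n)) *
          ((B + 1) * (ε : ℝ)⁻¹ ^ n)) := by
          gcongr
          norm_num
      _ = _ := by
          have h2 : (ε : ℝ) ^ (d + n + n) * (ε : ℝ)⁻¹ ^ (d + n + n) = 1 := by
            rw [← mul_pow, mul_inv_cancel₀ h0.ne', one_pow]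
          have h3 : (ε : ℝ) ^ m = (ε : ℝ) ^ p * (ε : ℝ) ^ (d + n + n) := pow_add _ _ _
          rw [h3]
          linear_combination (2 ^ n * (A * 4 ^ m * (B + 1)) * (ε : ℝ) ^ p) * h2

theorem thetaFun_eq_zero (ρ : 𝓢(Sp d, ℂ)) {χ : 𝓓((⊤ : Opens (Sp d)), ℝ)} (hχ : IsCutoff χ)
    {ε : Idx} {x : Sp d} (hx : 2 ≤ |Real.log ε| * ‖x‖) : thetaFun ρ χ ε x = 0 := by
  have : χ (|Real.log ε| • x) = 0 := hχ.eq_zero _ (by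
    rw [mem_ball_zero_iff, norm_smul, Real.norm_eq_abs, abs_abs, not_lt]
    exact hx)
  simp [thetaFun, chiEps, this]

/-! ### Convolution with distributions -/

/-- Multiplying by `ψ` leaves the test function `φ(y - ·)` unchanged. Through this the bounds for
`ℰ'` become available for arbitrary distributions. -/
theorem Distr.conv_eq_cut_conv (T : Distr d) (ψ : 𝓓((⊤ : Opens (Sp d)), ℝ)) (φ : Test d)
    {y : Sp d} (h : ∀ x, φ (y - x) ≠ 0 → ψ x = 1) :
    T.conv φ y = (T.cut ψ).conv φ φ.contDiff y := by
  change T (φ.flip y) = T (mulTest ψ (Smooth.flip φ φ.contDiff y))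
  congr 1
  ext x
  change φ (y - x) = (ψ x : ℂ) * φ (y - x)
  by_cases hx : φ (y - x) = 0
  · rw [hx, mul_zero]
  · rw [h x hx, Complex.ofReal_one, one_mul]

theorem exists_test_eq_one_on_closedBall (R : ℝ) :
    ∃ ψ : 𝓓((⊤ : Opens (Sp d)), ℝ), ∀ x : Sp d, ‖x‖ ≤ R → ψ x = 1 := by
  let b : ContDiffBump (0 : Sp d) := ⟨|R| + 1, |R| + 2, by positivity, by linarith⟩
  refine ⟨⟨b, b.contDiff, b.hasCompactSupport, fun _ _ => trivial⟩, fun x hx => ?_⟩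
  refine b.one_of_mem_closedBall ?_
  rw [mem_closedBall_zero_iff]
  change ‖x‖ ≤ |R| + 1
  linarith [le_abs_self R]

theorem netS_of_lt_one (ρ : 𝓢(Sp d, ℂ)) (χ : 𝓓((⊤ : Opens (Sp d)), ℝ)) (T : Distr d) {ε : Idx}
    (hε : (ε : ℝ) < 1) : netS ρ χ T ε = T.conv (thetaEps ρ χ ε hε) :=
  dif_pos hε

theorem netS_eq_cut_conv (ρ : 𝓢(Sp d, ℂ)) {χ : 𝓓((⊤ : Opens (Sp d)), ℝ)} (hχ : IsCutoff χ)
    (T : Distr d) (ψ : 𝓓((⊤ : Opens (Sp d)), ℝ)) {ε : Idx} (hε : (ε : ℝ) < 1) {y : Sp d}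
    (h : ∀ x, |Real.log ε| * dist x y < 2 → ψ x = 1) :
    netS ρ χ T ε y = (T.cut ψ).conv (thetaFun ρ χ ε) (contDiff_thetaFun ρ χ ε) y := by
  rw [netS_of_lt_one ρ χ T hε]
  refine T.conv_eq_cut_conv ψ _ fun x hx => h x ?_
  by_contra hx'
  refine hx (thetaFun_eq_zero ρ hχ ?_)
  rw [← dist_eq_norm, dist_comm]
  exact not_lt.1 hx'

theorem contDiff_netS (ρ : 𝓢(Sp d, ℂ)) {χ : 𝓓((⊤ : Opens (Sp d)), ℝ)} (hχ : IsCutoff χ)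
    (T : Distr d) (ε : Idx) : ContDiff ℝ ∞ (netS ρ χ T ε) := by
  by_cases hε : (ε : ℝ) < 1
  · refine contDiff_iff_contDiffAt.2 fun y₀ => ?_
    have hL : 0 < |Real.log ε| := abs_pos.2 (Real.log_neg ε.2.1 hε).ne
    -- One cutoff has to serve a whole neighbourhood of `y₀`: `2/|ln ε|` is the radius of the
    -- support of `θ_ε`, and `1` is the room for `y` to move.
    obtain ⟨ψ, hψ⟩ := exists_test_eq_one_on_closedBall (d := d) (2 / |Real.log ε| + (1 + ‖y₀‖))
    refine ((T.cut ψ).contDiff_conv _ (contDiff_thetaFun ρ χ ε)).contDiffAt.congr_of_eventuallyEq ?_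
    filter_upwards [Metric.ball_mem_nhds y₀ one_pos] with y hy
    refine netS_eq_cut_conv ρ hχ T ψ hε fun x hx => hψ x ?_
    have h1 : dist x y < 2 / |Real.log ε| := by rwa [lt_div_iff₀ hL, mul_comm]
    have h2 : dist y y₀ < 1 := hy
    have h3 := dist_triangle4 x y y₀ 0
    rw [dist_zero_right, dist_zero_right] at h3
    linarith
  · have : netS ρ χ T ε = fun _ => 0 := by
      unfold netS
      rw [dif_neg hε]
      rfl
    rw [this]
    exact contDiff_const

/-! ### Moderate and negligible nets -/

theorem eventually_toZero_lt {δ : ℝ} (hδ : 0 < δ) : ∀ᶠ ε : Idx in toZero, (ε : ℝ) < δ :=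
  (tendsto_comap (f := fun ε : Idx => (ε : ℝ)) (x := 𝓝 0)).eventually_lt_const hδ

theorem eventually_toZero_lt_abs_log (A : ℝ) : ∀ᶠ ε : Idx in toZero, A < |Real.log ε| := by
  filter_upwards [eventually_toZero_lt (Real.exp_pos (-A))] with ε hε
  have h1 := Real.log_lt_log ε.2.1 hε
  rw [Real.log_exp] at h1
  exact (lt_neg_of_lt_neg h1).trans_le (neg_le_abs _)

theorem pow_succ_isLittleO_pow (p : ℕ) :
    (fun ε : Idx => (ε : ℝ) ^ (p + 1)) =o[toZero] fun ε : Idx => (ε : ℝ) ^ p := by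
  have h : Tendsto (fun ε : Idx => (ε : ℝ)) toZero (𝓝 0) := tendsto_comap
  have h1 : (fun ε : Idx => (ε : ℝ)) =o[toZero] fun _ : Idx => (1 : ℝ) :=
    (isLittleO_one_iff ℝ).2 h
  simpa [pow_succ] using (isBigO_refl (fun ε : Idx => (ε : ℝ) ^ p) toZero).mul_isLittleO h1

theorem inv_pow_isLittleO (q : ℕ) : (fun ε : Idx => (ε : ℝ)⁻¹ ^ q) =o[toZero]
    fun ε : Idx => (ε : ℝ) ^ (-((q + 1 : ℕ) : ℤ)) := by
  have h : Tendsto (fun ε : Idx => (ε : ℝ)) toZero (𝓝 0) := tendsto_comap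
  have h1 : (fun ε : Idx => (ε : ℝ)) =o[toZero] fun _ : Idx => (1 : ℝ) :=
    (isLittleO_one_iff ℝ).2 h
  refine ((isBigO_refl (fun ε : Idx => (ε : ℝ)⁻¹ ^ (q + 1)) toZero).mul_isLittleO h1).congr
    (fun ε => ?_) fun ε => ?_
  · have h0 : (ε : ℝ) ≠ 0 := ε.2.1.ne'
    rw [pow_succ, mul_assoc, inv_mul_cancel₀ h0, mul_one]
  · rw [mul_one, zpow_neg, zpow_natCast, inv_pow]

/-- A bound `O(ε^{-q})` suffices, because it is `o(ε^{-(q+1)})`. -/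
theorem isModerate_of_eventually_le {f : Idx → Sp d → ℂ} (hf : ∀ ε, ContDiff ℝ ∞ (f ε))
    (h : ∀ (l : ℕ) (K : Set (Sp d)), IsCompact K → ∃ (q : ℕ) (C : ℝ), 0 ≤ C ∧ ∀ᶠ ε : Idx in toZero,
      ∀ k ≤ l, ∀ x ∈ K, ‖iteratedFDeriv ℝ k (f ε) x‖ ≤ C * (ε : ℝ)⁻¹ ^ q) : IsModerate f := by
  refine ⟨hf, fun l K hK _ => ?_⟩
  obtain ⟨q, C, hC, hb⟩ := h l K hK
  refine ⟨q + 1, IsBigO.trans_isLittleO (IsBigO.of_bound C ?_) (inv_pow_isLittleO q)⟩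
  filter_upwards [hb] with ε hε
  have h0 : (0 : ℝ) < ε := ε.2.1
  rw [Real.norm_of_nonneg (seminorm_nonneg _), Real.norm_of_nonneg (by positivity)]
  refine seminorm_le (by positivity) fun k hk x hx => ?_
  rw [ext_of]
  exact hε k hk x hx

theorem G.restrict_classOf_eq {f g : Idx → Sp d → ℂ} (hf : IsModerate f) (hg : IsModerate g)
    (Ω : Opens (Sp d))
    (h : ∀ (l : ℕ) (K : Set (Sp d)), IsCompact K → K ⊆ Ω → ∀ p : ℕ, ∃ C : ℝ, 0 ≤ C ∧
      ∀ᶠ ε : Idx in toZero, ∀ k ≤ l, ∀ x ∈ K,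
        ‖iteratedFDeriv ℝ k (fun y => f ε y - g ε y) x‖ ≤ C * (ε : ℝ) ^ p) :
    G.restrict (le_top : Ω ≤ ⊤) (classOf f hf) = G.restrict le_top (classOf g hg) := by
  refine Ideal.Quotient.eq.2 fun l K hK hKΩ p => ?_
  -- The spare power of `ε` turns the `O`-bound into the required `o(ε^p)`.
  obtain ⟨C, hC, hb⟩ := h l K hK hKΩ (p + 1)
  refine IsBigO.trans_isLittleO (IsBigO.of_bound C ?_) (pow_succ_isLittleO_pow p)
  filter_upwards [hb] with ε hε
  have h0 : (0 : ℝ) < ε := ε.2.1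
  rw [Real.norm_of_nonneg (seminorm_nonneg _), Real.norm_of_nonneg (by positivity)]
  change seminorm K l ((Smooth.of ⊤ (fun y => f ε y - g ε y)
    ((hf.fst ε).sub (hg.fst ε))).restrict (le_top : Ω ≤ ⊤)) ≤ _
  rw [seminorm_restrict _ hKΩ]
  refine seminorm_le (by positivity) fun k hk x hx => ?_
  rw [ext_of]
  exact hε k hk x hx

theorem seminorm_biUnion_le {Ω : Opens (Sp d)} {ι : Type*} (t : Finset ι) {K : ι → Set (Sp d)}
    (hK : ∀ i, IsCompact (K i)) (hKΩ : ∀ i ∈ t, K i ⊆ Ω) (l : ℕ) (f : Smooth Ω) :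
    seminorm (⋃ i ∈ t, K i) l f ≤ ∑ i ∈ t, seminorm (K i) l f := by
  refine seminorm_le (Finset.sum_nonneg fun _ _ => seminorm_nonneg f) fun k hk x hx => ?_
  obtain ⟨i, hi, hxi⟩ := mem_iUnion₂.1 hx
  exact (le_seminorm (hK i) (hKΩ i hi) f hk hxi).trans
    (Finset.single_le_sum (f := fun i => seminorm (K i) l f) (fun _ _ => seminorm_nonneg f) hi)

/-- Negligibility is local: a compact set is a finite union of compact pieces, each inside one
member of the cover, and its seminorm is at most the sum of theirs. -/
theorem G.eq_of_restrict_eq {Λ : Type*} {Ω : Λ → Opens (Sp d)}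
    (hΩ : ⋃ i, (Ω i : Set (Sp d)) = Set.univ) {u v : G (⊤ : Opens (Sp d))}
    (h : ∀ i, G.restrict (le_top : Ω i ≤ ⊤) u = G.restrict le_top v) : u = v := by
  obtain ⟨f, rfl⟩ := Ideal.Quotient.mk_surjective u
  obtain ⟨g, rfl⟩ := Ideal.Quotient.mk_surjective v
  refine Ideal.Quotient.eq.2 fun l K hK _ p => ?_
  obtain ⟨t, ht⟩ := hK.elim_finite_subcover (fun i => (Ω i : Set (Sp d)))
    (fun i => (Ω i).isOpen) (hΩ ▸ subset_univ K)
  obtain ⟨K', hK', hK'Ω, rfl⟩ := hK.finite_compact_cover t (fun i => (Ω i : Set (Sp d)))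
    (fun i _ => (Ω i).isOpen) ht
  have hsum : (fun ε : Idx => ∑ i ∈ t, seminorm (K' i) l ((f - g).1 ε)) =o[toZero]
      fun ε : Idx => (ε : ℝ) ^ p := by
    refine IsLittleO.fun_sum fun i _ => ?_
    have h1 := Ideal.Quotient.eq.1 (h i) l (K' i) (hK' i) (hK'Ω i) p
    change (fun ε : Idx => seminorm (K' i) l
      (((f - g).1 ε).restrict (le_top : Ω i ≤ ⊤))) =o[toZero] fun ε : Idx => (ε : ℝ) ^ p at h1
    simpa only [seminorm_restrict _ (hK'Ω i)] using h1
  refine IsBigO.trans_isLittleO (IsBigO.of_bound 1 (Eventually.of_forall fun ε => ?_)) hsum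
  rw [one_mul, Real.norm_of_nonneg (seminorm_nonneg _)]
  exact (seminorm_biUnion_le t hK' (fun _ _ => subset_univ _) l _).trans (le_abs_self _)

/-! ### The embeddings -/

theorem CDistr.exists_norm_iteratedFDeriv_conv_thetaFun_le (S : CDistr d) (ρ : 𝓢(Sp d, ℂ))
    (χ : 𝓓((⊤ : Opens (Sp d)), ℝ)) (l : ℕ) : ∃ (q : ℕ) (C : ℝ), 0 ≤ C ∧ ∀ k ≤ l, ∀ (ε : Idx)
      (y : Sp d), ‖iteratedFDeriv ℝ k (S.conv (thetaFun ρ χ ε) (contDiff_thetaFun ρ χ ε)) y‖ ≤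
        C * (ε : ℝ)⁻¹ ^ q := by
  obtain ⟨K, l', C, _, hC, hb⟩ := S.exists_convBound
  obtain ⟨A, hA, hA'⟩ := exists_norm_iteratedFDeriv_thetaFun_le ρ χ (l' + l)
  refine ⟨d + (l' + l) + (l' + l), C * A, by positivity, fun k hk ε y => ?_⟩
  have h0 : (0 : ℝ) < ε := ε.2.1
  rw [mul_assoc]
  exact hb.norm_iteratedFDeriv_conv_le k _ _ y hC (by positivity)
    fun j hj x _ => hA' j (by omega) ε _

theorem isModerate_netZero (ρ : 𝓢(Sp d, ℂ)) (S : CDistr d) : IsModerate (netZero ρ S) := by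
  refine isModerate_of_eventually_le (fun ε => S.contDiff_conv _ _) fun l _ _ => ?_
  obtain ⟨K, l', C, _, hC, hb⟩ := S.exists_convBound
  obtain ⟨A, hA, hA'⟩ := exists_norm_iteratedFDeriv_rhoEps_le ρ (l' + l)
  refine ⟨d + (l' + l), C * A, by positivity, Eventually.of_forall fun ε k hk y _ => ?_⟩
  have h0 : (0 : ℝ) < ε := ε.2.1
  rw [mul_assoc]
  exact hb.norm_iteratedFDeriv_conv_le k _ _ y hC (by positivity)
    fun j hj x _ => hA' j (by omega) ε _

theorem isModerate_netS (ρ : 𝓢(Sp d, ℂ)) {χ : 𝓓((⊤ : Opens (Sp d)), ℝ)} (hχ : IsCutoff χ)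
    (T : Distr d) : IsModerate (netS ρ χ T) := by
  refine isModerate_of_eventually_le (contDiff_netS ρ hχ T) fun l K hK => ?_
  obtain ⟨R, hR⟩ := hK.isBounded.exists_norm_le
  -- Once `|ln ε| > 1`, the support of `θ_ε` has radius at most `2`, so a single cutoff works for
  -- all small `ε` and all points within distance one of `K`.
  obtain ⟨ψ, hψ⟩ := exists_test_eq_one_on_closedBall (d := d) (2 + (1 + R))
  obtain ⟨q, C, hC, hb⟩ := (T.cut ψ).exists_norm_iteratedFDeriv_conv_thetaFun_le ρ χ l
  refine ⟨q, C, hC, ?_⟩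
  filter_upwards [eventually_toZero_lt one_pos, eventually_toZero_lt_abs_log 1] with ε h1 hL k hk
    y₀ hy₀
  have he : netS ρ χ T ε =ᶠ[𝓝 y₀]
      (T.cut ψ).conv (thetaFun ρ χ ε) (contDiff_thetaFun ρ χ ε) := by
    filter_upwards [Metric.ball_mem_nhds y₀ one_pos] with y hy
    refine netS_eq_cut_conv ρ hχ T ψ h1 fun x hx => hψ x ?_
    have h2 : dist x y < 2 := (le_mul_of_one_le_left dist_nonneg hL.le).trans_lt hx
    have h3 : dist y y₀ < 1 := hy
    have h4 := dist_triangle4 x y y₀ 0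
    rw [dist_zero_right, dist_zero_right] at h4
    linarith [hR y₀ hy₀]
  rw [(he.iteratedFDeriv ℝ k).eq_of_nhds]
  exact hb k hk ε y₀

/-- Near a compact subset of `Ω i` and for small `ε`, both nets are convolutions of the same `ψ_i
T`, with kernels `ρ_ε` and `θ_ε` whose difference is negligible uniformly on `ℝ^d`. -/
theorem isGluing_iotaS (ρ : 𝓢(Sp d, ℂ)) {χ : 𝓓((⊤ : Opens (Sp d)), ℝ)} (hχ : IsCutoff χ)
    {Λ : Type*} {Ω : Λ → Opens (Sp d)} {ψ : Λ → 𝓓((⊤ : Opens (Sp d)), ℝ)}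
    (hψ : ∀ i, ∀ x ∈ Ω i, ψ i x = 1) :
    IsGluing ρ (isModerate_netZero ρ) Ω ψ (iotaS ρ χ (isModerate_netS ρ hχ)) := by
  refine fun i T => (G.restrict_classOf_eq (isModerate_netZero ρ _) (isModerate_netS ρ hχ T) (Ω i)
    fun l K hK hKΩ p => ?_).symm
  obtain ⟨K', l', C, _, hC, hb⟩ := (T.cut (ψ i)).exists_convBound
  obtain ⟨A, hA, hA'⟩ := exists_norm_iteratedFDeriv_rhoEps_sub_thetaFun_le ρ hχ (l' + l) p
  refine ⟨C * A, by positivity, ?_⟩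
  obtain ⟨δ, hδ, hδΩ⟩ := hK.exists_cthickening_subset_open (Ω i).isOpen hKΩ
  -- Half of `δ` is for the support of `θ_ε`, the other half for `y` near `y₀`: equality of germs is
  -- needed in order to compare derivatives.
  filter_upwards [eventually_toZero_lt one_pos, eventually_toZero_lt_abs_log (2 / (δ / 2))]
    with ε h1 hL k hk y₀ hy₀
  have h0 : (0 : ℝ) < ε := ε.2.1
  have he : (fun y => netZero ρ (T.cut (ψ i)) ε y - netS ρ χ T ε y) =ᶠ[𝓝 y₀]
      (T.cut (ψ i)).conv (fun x => rhoEps ρ ε x - thetaFun ρ χ ε x)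
        ((contDiff_rhoEps ρ ε).sub (contDiff_thetaFun ρ χ ε)) := by
    filter_upwards [Metric.ball_mem_nhds y₀ (half_pos hδ)] with y hy
    rw [CDistr.conv_sub, netS_eq_cut_conv ρ hχ T (ψ i) h1 fun x hx => hψ i x ?_]
    · rfl
    · have hL0 : 0 < |Real.log ε| := lt_trans (by positivity) hL
      have h2 : dist x y < δ / 2 := by
        rw [div_lt_iff₀ (half_pos hδ)] at hL
        exact lt_of_mul_lt_mul_left (hx.trans hL) hL0.le
      have h3 : dist y y₀ < δ / 2 := hy
      refine hδΩ (Metric.mem_cthickening_of_dist_le x y₀ δ K hy₀ ?_)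
      linarith [dist_triangle x y y₀]
  rw [(he.iteratedFDeriv ℝ k).eq_of_nhds, mul_assoc]
  exact hb.norm_iteratedFDeriv_conv_le k _ _ y₀ hC (by positivity)
    fun j hj x _ => hA' j (by omega) ε _

end Colombeau

theorem mainTheorem2 {d : ℕ} (ρ : 𝓢(Colombeau.Sp d, ℂ)) (hρ : Colombeau.IsMollifier ρ)
    (χ : 𝓓((⊤ : Opens (Colombeau.Sp d)), ℝ)) (hχ : Colombeau.IsCutoff χ)
    {Λ : Type*} (Ω : Λ → Opens (Colombeau.Sp d)) (ψ : Λ → 𝓓((⊤ : Opens (Colombeau.Sp d)), ℝ))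
    (hΩψ : Colombeau.IsCutoffCover Ω ψ) :
    ∃ (hZero : ∀ S : Colombeau.CDistr d, Colombeau.IsModerate (Colombeau.netZero ρ S))
      (hS : ∀ T : Colombeau.Distr d, Colombeau.IsModerate (Colombeau.netS ρ χ T)),
      (∃! ι : Colombeau.Distr d → Colombeau.G (⊤ : Opens (Colombeau.Sp d)),
        Colombeau.IsGluing ρ hZero Ω ψ ι) ∧
      ∀ ιA : Colombeau.Distr d → Colombeau.G (⊤ : Opens (Colombeau.Sp d)),
        Colombeau.IsGluing ρ hZero Ω ψ ιA → ιA = Colombeau.iotaS ρ χ hS := by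
  have hψ : ∀ i, ∀ x ∈ Ω i, ψ i x = 1 := fun i x hx =>
    (hΩψ.eq_one i).self_of_nhdsSet x (subset_closure hx)
  have hglue := Colombeau.isGluing_iotaS ρ hχ hψ
  have huniq : ∀ ιA, Colombeau.IsGluing ρ (Colombeau.isModerate_netZero ρ) Ω ψ ιA →
      ιA = Colombeau.iotaS ρ χ (Colombeau.isModerate_netS ρ hχ) := fun ιA hA =>
    funext fun T => Colombeau.G.eq_of_restrict_eq hΩψ.cover fun i =>
      (hA i T).trans (hglue i T).symm
  -- The existence witness is `iotaS` itself, so `huniq` serves both for uniqueness and for the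
  -- final identity.
  exact ⟨Colombeau.isModerate_netZero ρ, Colombeau.isModerate_netS ρ hχ,
    ⟨_, hglue, huniq⟩, huniq⟩
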